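/- Let $\widehat{\mathrm{G}}_0^1$ denote the group of formal diffeomorphisms of $(\mathbb{C},0)$, that is, the set of formal power series $\widehat f(x)=\sum_{i\ge 1}a_ix^i\in\mathbb{C}[[x]]$ with zero constant term and $a_1\neq 0$, endowed with the composition law $(\widehat f\,\widehat g)(x)=\widehat f(\widehat g(x))$. Then $\widehat{\mathrm{G}}_0^1$ is Hopfian: every surjective group homomorphism $\widehat{\mathrm{G}}_0^1\to\widehat{\mathrm{G}}_0^1$ is an isomorphism. -/

import Mathlib

/-- A group is Hopfian if every surjective endomorphism of it is an isomorphism. -/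
def IsHopfianGroup (G : Type*) [Group G] : Prop :=
  ∀ φ : G →* G, Function.Surjective φ → Function.Bijective φ

/-- Formal diffeomorphisms of `(ℂ, 0)`: formal power series in one variable with complex
coefficients, zero constant term and invertible (i.e. nonzero) linear coefficient. -/
@[ext]
structure FormalDiff where
  /-- the underlying formal power series -/
  series : PowerSeries ℂ
  constantCoeff_eq_zero : PowerSeries.constantCoeff series = 0
  coeff_one_ne_zero : PowerSeries.coeff 1 series ≠ 0

namespace FormalDiff

theorem hasSubst (f : FormalDiff) : PowerSeries.HasSubst f.series :=
  PowerSeries.HasSubst.of_constantCoeff_zero' f.constantCoeff_eq_zero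

theorem coeff_one_subst (f g : FormalDiff) :
    PowerSeries.coeff 1 (f.series.subst g.series) =
      PowerSeries.coeff 1 f.series * PowerSeries.coeff 1 g.series := by
  obtain ⟨p, hp⟩ := PowerSeries.X_dvd_iff.mpr f.constantCoeff_eq_zero
  have hg := g.hasSubst
  have h0 : PowerSeries.constantCoeff (p.subst g.series) = PowerSeries.constantCoeff p := by
    obtain ⟨q, hq⟩ : PowerSeries.X ∣ p - PowerSeries.C (PowerSeries.constantCoeff p) :=
      PowerSeries.X_dvd_iff.mpr (by simp)
    have hp' : p = PowerSeries.X * q + PowerSeries.C (PowerSeries.constantCoeff p) := by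
      rw [← hq]; ring
    have e : p.subst g.series = g.series * q.subst g.series +
        PowerSeries.C (PowerSeries.constantCoeff p) := by
      conv_lhs => rw [hp']
      rw [PowerSeries.subst_add hg, PowerSeries.subst_mul hg, PowerSeries.subst_X hg,
        PowerSeries.subst_C]
      rfl
    rw [e]
    simp [g.constantCoeff_eq_zero]
  rw [hp, PowerSeries.subst_mul hg, PowerSeries.subst_X hg]
  simp [PowerSeries.coeff_mul, Finset.Nat.antidiagonal_succ, g.constantCoeff_eq_zero, h0,
    mul_comm]

/-- The identity `x ↦ x`. -/
noncomputable instance : One FormalDiff :=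
  ⟨⟨PowerSeries.X, by simp, by simp⟩⟩

/-- The product is composition: `(f * g)(x) = f (g x)`. -/
noncomputable instance : Mul FormalDiff :=
  ⟨fun f g => ⟨f.series.subst g.series,
    PowerSeries.constantCoeff_subst_eq_zero g.constantCoeff_eq_zero _ f.constantCoeff_eq_zero,
    by rw [coeff_one_subst]; exact mul_ne_zero f.coeff_one_ne_zero g.coeff_one_ne_zero⟩⟩

/-- The inverse is the compositional inverse. -/
noncomputable instance : Inv FormalDiff :=
  ⟨fun f => ⟨f.series.substInvOfIsUnit f.coeff_one_ne_zero.isUnit,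
    PowerSeries.constantCoeff_substInvOfIsUnit _ _,
    by rw [PowerSeries.coeff_one_substInvOfIsUnit]; exact Units.ne_zero _⟩⟩

@[simp]
theorem series_one : (1 : FormalDiff).series = PowerSeries.X := rfl

@[simp]
theorem series_mul (f g : FormalDiff) : (f * g).series = f.series.subst g.series := rfl

/-- The group of formal diffeomorphisms of `(ℂ, 0)` under composition. -/
noncomputable instance : Group FormalDiff :=
  Group.ofLeftAxioms
    (fun f g h => FormalDiff.ext
      (PowerSeries.subst_comp_subst_apply g.hasSubst h.hasSubst f.series))
    (fun f => FormalDiff.ext (PowerSeries.subst_X f.hasSubst))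
    (fun f => FormalDiff.ext
      (PowerSeries.subst_substInvOfIsUnit_left f.series f.constantCoeff_eq_zero
        f.coeff_one_ne_zero.isUnit))

end FormalDiff

/-!
The group `G` of formal diffeomorphisms is filtered by the normal subgroups `G_k` of series congruent
to `X` modulo `X ^ (k + 1)`. The argument compares this filtration with the derived series.

* The quotients `G / G_k` are solvable: the `n`-th derived subgroup lies in `G_n`
  (`derivedSeries_le_tangent`).
* If `f ∈ G_k` has a nonzero coefficient in degree `k + 1`, with `k ≥ 1`, then `f` and `f * h` are
  conjugate for every `h ∈ G_{2k+1}` (`exists_conj_eq_mul`): in the equation `f ∘ g = g ∘ F`, with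
  `F = f * h`, the coefficient of `g` in degree `n + 1` first enters in degree `n + k + 1`, multiplied by
  `a * (k - n)`, where `a` is the leading coefficient of `f - X`. For `n > k` this factor does not
  vanish, so the coefficients of `g` are found one after the other.

By the second fact every `h ∈ G_{2k+1}` is a commutator with `f`. Hence a nontrivial normal subgroup
contains some `G_m` (`exists_tangent_le_of_normal`), and so does every term of the derived series
(`exists_tangent_le_derivedSeries`). In particular `G` is not solvable, whereas all its proper quotients
are. A surjective endomorphism with nontrivial kernel would present `G` as a proper quotient of itself.
-/

namespace FormalDiff

open PowerSeries commutatorElement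

/-! ### Congruences between substituted power series -/

theorem hasSubst_of_X_dvd {a : ℂ⟦X⟧} (ha : X ∣ a) : HasSubst a :=
  HasSubst.of_constantCoeff_zero' (X_dvd_iff.mp ha)

theorem X_dvd_series (f : FormalDiff) : X ∣ f.series :=
  X_dvd_iff.mpr f.constantCoeff_eq_zero

theorem X_pow_dvd_subst {n : ℕ} {p a : ℂ⟦X⟧} (ha : X ∣ a) (hp : X ^ n ∣ p) :
    X ^ n ∣ p.subst a := by
  obtain ⟨q, rfl⟩ := hp
  have h := hasSubst_of_X_dvd ha
  rw [subst_mul h, subst_pow h, subst_X h]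
  exact Dvd.dvd.mul_right (pow_dvd_pow_of_dvd ha n) _

theorem subst_sub' {a : ℂ⟦X⟧} (ha : X ∣ a) (p q : ℂ⟦X⟧) :
    (p - q).subst a = p.subst a - q.subst a := by
  have h := hasSubst_of_X_dvd ha
  rw [eq_sub_iff_add_eq, ← subst_add h, sub_add_cancel]

theorem subst_C_add_X_mul {a : ℂ⟦X⟧} (ha : X ∣ a) (c : ℂ) (q : ℂ⟦X⟧) :
    (C c + X * q).subst a = C c + a * q.subst a := by
  have h := hasSubst_of_X_dvd ha
  rw [subst_add h, subst_mul h, subst_X h, subst_C]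
  rfl

theorem exists_eq_C_add_X_mul (p : ℂ⟦X⟧) : ∃ q, p = C (constantCoeff p) + X * q := by
  obtain ⟨q, hq⟩ : X ∣ p - C (constantCoeff p) := X_dvd_iff.mpr (by simp)
  exact ⟨q, by rw [← hq]; ring⟩

theorem constantCoeff_subst_of_X_dvd {a : ℂ⟦X⟧} (ha : X ∣ a) (p : ℂ⟦X⟧) :
    constantCoeff (p.subst a) = constantCoeff p := by
  obtain ⟨q, hq⟩ := exists_eq_C_add_X_mul p
  conv_lhs => rw [hq]
  rw [subst_C_add_X_mul ha]
  simp [X_dvd_iff.mp ha]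

/-- Substitution respects congruences modulo powers of `X`. -/
theorem X_pow_dvd_subst_sub_subst {a b : ℂ⟦X⟧} (ha : X ∣ a) (hb : X ∣ b) (n : ℕ)
    (h : X ^ n ∣ a - b) (p : ℂ⟦X⟧) : X ^ n ∣ p.subst a - p.subst b := by
  induction n generalizing p with
  | zero => simp
  | succ n ih =>
    obtain ⟨q, hq⟩ := exists_eq_C_add_X_mul p
    rw [hq, subst_C_add_X_mul ha, subst_C_add_X_mul hb]
    have e : C (constantCoeff p) + a * q.subst a - (C (constantCoeff p) + b * q.subst b) =
        (a - b) * q.subst a + b * (q.subst a - q.subst b) := by ring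
    rw [e]
    refine dvd_add (Dvd.dvd.mul_right h _) ?_
    rw [pow_succ']
    exact mul_dvd_mul hb (ih ((pow_dvd_pow _ n.le_succ).trans h) q)

theorem subst_X_add_X_pow_mul {a : ℂ⟦X⟧} (ha : X ∣ a) (n : ℕ) (u : ℂ⟦X⟧) :
    (X + X ^ n * u).subst a = a + a ^ n * u.subst a := by
  have h := hasSubst_of_X_dvd ha
  rw [subst_add h, subst_mul h, subst_pow h, subst_X h]

/-! ### The filtration by order of tangency to the identity -/

theorem X_pow_dvd_series_mul_sub {k : ℕ} {f : FormalDiff} (hf : X ^ k ∣ f.series - X)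
    (g : FormalDiff) : X ^ k ∣ (f * g).series - g.series := by
  have h := X_pow_dvd_subst g.X_dvd_series hf
  rwa [subst_sub' g.X_dvd_series, subst_X g.hasSubst] at h

theorem X_pow_dvd_series_sub_X_iff {k : ℕ} (f g : FormalDiff) :
    X ^ k ∣ f.series - X ↔ X ^ k ∣ (f * g).series - g.series := by
  refine ⟨fun h => X_pow_dvd_series_mul_sub h g, fun h => ?_⟩
  have h' := X_pow_dvd_subst (g⁻¹).X_dvd_series h
  rw [subst_sub' (g⁻¹).X_dvd_series, ← series_mul, ← series_mul] at h'
  simpa using h'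

/-- The subgroup `G_k` of formal diffeomorphisms congruent to `X` modulo `X ^ (k + 1)`; thus `G_0` is the
whole group and `G_1` consists of the diffeomorphisms tangent to the identity. -/
def tangent (k : ℕ) : Subgroup FormalDiff where
  carrier := {f | X ^ (k + 1) ∣ f.series - X}
  one_mem' := by simp
  mul_mem' {f g} hf hg := by
    have h := dvd_add (X_pow_dvd_series_mul_sub hf g) hg
    rwa [sub_add_sub_cancel] at h
  inv_mem' {f} hf := by
    have h := X_pow_dvd_series_mul_sub hf f⁻¹
    rw [mul_inv_cancel, series_one] at h
    exact (dvd_sub_comm).mp h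

theorem mem_tangent {k : ℕ} {f : FormalDiff} : f ∈ tangent k ↔ X ^ (k + 1) ∣ f.series - X :=
  Iff.rfl

theorem tangent_antitone : Antitone tangent := fun _ _ h _ hf =>
  (pow_dvd_pow _ (Nat.succ_le_succ h)).trans hf

theorem mem_tangent_zero (f : FormalDiff) : f ∈ tangent 0 := by
  rw [mem_tangent, zero_add, pow_one]
  exact dvd_sub f.X_dvd_series dvd_rfl

theorem eq_one_of_forall_mem_tangent {f : FormalDiff} (hf : ∀ k, f ∈ tangent k) : f = 1 := by
  refine FormalDiff.ext (sub_eq_zero.mp (PowerSeries.ext fun n => ?_))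
  exact X_pow_dvd_iff.mp (hf n) n n.lt_succ_self

theorem exists_series_eq_of_mem_tangent {k : ℕ} {f : FormalDiff} (hf : f ∈ tangent k) :
    ∃ u, f.series = X + X ^ (k + 1) * u := by
  obtain ⟨u, hu⟩ := hf
  exact ⟨u, by rw [← hu]; ring⟩

/-- Composition on `G_k / G_{k+1}` is multiplication of linear coefficients for `k = 0` and addition of
the coefficients in degree `k + 1` for `k ≥ 1`, so it is commutative. -/
theorem commutator_tangent_le (k : ℕ) : ⁅tangent k, tangent k⁆ ≤ tangent (k + 1) := by
  rw [Subgroup.commutator_le]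
  intro f hf g hg
  obtain ⟨u, hu⟩ := exists_series_eq_of_mem_tangent hf
  obtain ⟨v, hv⟩ := exists_series_eq_of_mem_tangent hg
  rw [mem_tangent, X_pow_dvd_series_sub_X_iff _ (g * f)]
  have e : ⁅f, g⁆ * (g * f) = f * g := by simp [commutatorElement_def, mul_assoc]
  rw [e, series_mul, series_mul]
  have h1 : f.series.subst g.series =
      g.series + X ^ (k + 1) * ((1 + X ^ k * v) ^ (k + 1) * u.subst g.series) := by
    rw [hu, subst_X_add_X_pow_mul g.X_dvd_series, ← mul_assoc, ← mul_pow]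
    congr 3
    rw [hv]; ring
  have h2 : g.series.subst f.series =
      f.series + X ^ (k + 1) * ((1 + X ^ k * u) ^ (k + 1) * v.subst f.series) := by
    rw [hv, subst_X_add_X_pow_mul f.X_dvd_series, ← mul_assoc, ← mul_pow]
    congr 3
    rw [hu]; ring
  rw [h1, h2]
  have e2 : g.series + X ^ (k + 1) * ((1 + X ^ k * v) ^ (k + 1) * u.subst g.series) -
      (f.series + X ^ (k + 1) * ((1 + X ^ k * u) ^ (k + 1) * v.subst f.series)) =
      X ^ (k + 1) * (v - u + (1 + X ^ k * v) ^ (k + 1) * u.subst g.series -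
        (1 + X ^ k * u) ^ (k + 1) * v.subst f.series) := by
    rw [hu, hv]; ring
  rw [e2, pow_succ _ (k + 1)]
  refine mul_dvd_mul dvd_rfl (X_dvd_iff.mpr ?_)
  rcases k with _ | k
  · simp [constantCoeff_subst_of_X_dvd f.X_dvd_series,
      constantCoeff_subst_of_X_dvd g.X_dvd_series]
    ring
  · simp [constantCoeff_subst_of_X_dvd f.X_dvd_series,
      constantCoeff_subst_of_X_dvd g.X_dvd_series]

theorem derivedSeries_le_tangent (n : ℕ) : derivedSeries FormalDiff n ≤ tangent n := by
  induction n with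
  | zero => exact fun f _ => mem_tangent_zero f
  | succ n ih => exact (Subgroup.commutator_mono ih ih).trans (commutator_tangent_le n)

/-! ### Conjugacy of formal diffeomorphisms with a common jet -/

theorem constantCoeff_geom_sum {p q : ℂ⟦X⟧} (hp : constantCoeff p = 1) (hq : constantCoeff q = 1)
    (n : ℕ) : constantCoeff (∑ i ∈ Finset.range n, p ^ i * q ^ (n - 1 - i)) = n := by
  simp [hp, hq]

/-- The effect on `f ∘ g - g ∘ F` of changing `g` in degree `n + 1`, in the first degree where it is
visible. Here `f = X + X ^ (k + 1) * u`, `F = X + X ^ (k + 1) * v`, and `u`, `v` have the same constant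
coefficient `a`. -/
theorem exists_conj_defect_add_monomial {k n : ℕ} (hk : 1 ≤ k) (hn : 1 ≤ n) {u v g : ℂ⟦X⟧} {a : ℂ}
    (hu : constantCoeff u = a) (hv : constantCoeff v = a) (hg : X ^ 2 ∣ g - X) (b : ℂ) :
    ∃ w, constantCoeff w = a * (k - n) * b ∧
      (X + X ^ (k + 1) * u).subst (g + C b * X ^ (n + 1)) -
          (g + C b * X ^ (n + 1)).subst (X + X ^ (k + 1) * v) =
        (X + X ^ (k + 1) * u).subst g - g.subst (X + X ^ (k + 1) * v) + X ^ (n + k + 1) * w := by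
  obtain ⟨r, hr⟩ := hg
  obtain ⟨k, rfl⟩ := Nat.exists_eq_add_of_le' hk
  obtain ⟨n, rfl⟩ := Nat.exists_eq_add_of_le' hn
  have hgp : g = X * (1 + X * r) := by linear_combination hr
  have hgX : X ∣ g := ⟨_, hgp⟩
  set g' := g + C b * X ^ (n + 1 + 1) with hg'
  have hgp' : g' = X * (1 + X * r + C b * X ^ (n + 1)) := by rw [hg', hgp]; ring
  have hgX' : X ∣ g' := ⟨_, hgp'⟩
  set F : ℂ⟦X⟧ := X + X ^ (k + 1 + 1) * v with hF
  have hFp : F = X * (1 + X ^ (k + 1) * v) := by rw [hF]; ring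
  have hFX : X ∣ F := ⟨_, hFp⟩
  have hFs := hasSubst_of_X_dvd hFX
  obtain ⟨s, hs⟩ : X ^ (n + 1 + 1) ∣ u.subst g' - u.subst g :=
    X_pow_dvd_subst_sub_subst hgX' hgX _ ⟨C b, by rw [hg']; ring⟩ u
  have hus : constantCoeff (u.subst g) = a := by rw [constantCoeff_subst_of_X_dvd hgX, hu]
  have hF1 : g'.subst F = g.subst F + C b * F ^ (n + 1 + 1) := by
    rw [hg', subst_add hFs, subst_mul hFs, subst_pow hFs, subst_X hFs, subst_C]
    rfl
  set p := 1 + X * r with hp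
  set p' := p + C b * X ^ (n + 1) with hp'
  set q := 1 + X ^ (k + 1) * v with hq
  have hp0 : constantCoeff p = 1 := by simp [hp]
  have hp0' : constantCoeff p' = 1 := by simp [hp', hp0]
  have hq0 : constantCoeff q = 1 := by simp [hq]
  have hpow : p' ^ (k + 1 + 1) - p ^ (k + 1 + 1) = C b * X ^ (n + 1) *
      ∑ i ∈ Finset.range (k + 1 + 1), p' ^ i * p ^ (k + 1 + 1 - 1 - i) := by
    rw [← (Commute.all p' p).mul_geom_sum₂, hp']
    ring
  have hqow : q ^ (n + 1 + 1) - 1 = X ^ (k + 1) * v *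
      ∑ i ∈ Finset.range (n + 1 + 1), q ^ i * 1 ^ (n + 1 + 1 - 1 - i) := by
    have h := (Commute.all q 1).mul_geom_sum₂ (n + 1 + 1)
    rw [one_pow] at h
    rw [← h, hq]
    ring
  have hS := constantCoeff_geom_sum hp0' hp0 (k + 1 + 1)
  have hT := constantCoeff_geom_sum hq0 (map_one _) (n + 1 + 1)
  set S := ∑ i ∈ Finset.range (k + 1 + 1), p' ^ i * p ^ (k + 1 + 1 - 1 - i)
  set T := ∑ i ∈ Finset.range (n + 1 + 1), q ^ i * 1 ^ (n + 1 + 1 - 1 - i)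
  refine ⟨C b * S * u.subst g + p' ^ (k + 1 + 1) * X * s - C b * v * T, ?_, ?_⟩
  · simp only [map_sub, map_add, map_mul, hS, hT, hus, hv, constantCoeff_C, constantCoeff_X]
    push_cast
    ring
  · have hs' := eq_add_of_sub_eq hs
    have e1 : g' ^ (k + 1 + 1) = X ^ (k + 1 + 1) * p' ^ (k + 1 + 1) := by rw [hgp', mul_pow]
    have e2 : g ^ (k + 1 + 1) = X ^ (k + 1 + 1) * p ^ (k + 1 + 1) := by rw [hgp, mul_pow]
    have e3 : F ^ (n + 1 + 1) = X ^ (n + 1 + 1) * q ^ (n + 1 + 1) := by rw [hFp, mul_pow]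
    rw [subst_X_add_X_pow_mul hgX', subst_X_add_X_pow_mul hgX, hF1, hs', e1, e2, e3,
      eq_add_of_sub_eq hpow, eq_add_of_sub_eq hqow]
    linear_combination hg'

/-- Successive approximation in `ℂ⟦X⟧`: if an approximate solution can always be improved by adding a
monomial, with exponents increasing by one, then some series is congruent to approximate solutions of
every order. -/
theorem exists_series_of_successive_approximation {P : ℕ → ℂ⟦X⟧ → Prop} (m : ℕ) {g₀ : ℂ⟦X⟧}
    (h₀ : P 0 g₀) (step : ∀ i g, P i g → ∃ b, P (i + 1) (g + C b * X ^ (m + i))) :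
    ∃ g, ∀ i, ∃ g', P i g' ∧ X ^ (m + i) ∣ g - g' := by
  choose! b hb using step
  let G : ℕ → ℂ⟦X⟧ := fun i => Nat.rec g₀ (fun i g => g + C (b i g) * X ^ (m + i)) i
  have hG : ∀ i, P i (G i) := fun i => Nat.rec h₀ (fun i ih => hb i _ ih) i
  have hdiff : ∀ i j, X ^ (m + i) ∣ G (i + j) - G i := by
    intro i j
    induction j with
    | zero => simp
    | succ j ih =>
      have e : G (i + (j + 1)) - G i =
          G (i + j) - G i + C (b (i + j) (G (i + j))) * X ^ (m + (i + j)) := by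
        change G (i + j) + C (b (i + j) (G (i + j))) * X ^ (m + (i + j)) - G i = _
        ring
      rw [e]
      exact dvd_add ih (Dvd.dvd.mul_left (pow_dvd_pow _ (by omega)) _)
  -- The coefficient in degree `n` no longer changes after step `n + 1`.
  refine ⟨PowerSeries.mk fun n => coeff n (G (n + 1)), fun i => ⟨G i, hG i, ?_⟩⟩
  refine X_pow_dvd_iff.mpr fun n hn => ?_
  rw [map_sub, coeff_mk, sub_eq_zero]
  rcases le_total (n + 1) i with h | h
  · obtain ⟨j, rfl⟩ := Nat.exists_eq_add_of_le h
    have := X_pow_dvd_iff.mp (hdiff (n + 1) j) n (by omega)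
    rw [map_sub, sub_eq_zero] at this
    exact this.symm
  · obtain ⟨j, hj⟩ := Nat.exists_eq_add_of_le h
    have := X_pow_dvd_iff.mp (hdiff i j) n hn
    rwa [map_sub, sub_eq_zero, ← hj] at this

/-- If `f` is tangent to the identity to order exactly `k ≥ 1`, then it is conjugate to `f * h` for every
`h` tangent to the identity to order `2 * k + 1`. -/
theorem exists_conj_eq_mul {k : ℕ} (hk : 1 ≤ k) {f h : FormalDiff} (hf : f ∈ tangent k)
    (hfk : f ∉ tangent (k + 1)) (hh : h ∈ tangent (2 * k + 1)) :
    ∃ g ∈ tangent (k + 1), f * g = g * (f * h) := by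
  obtain ⟨u, hu⟩ := exists_series_eq_of_mem_tangent hf
  have ha : constantCoeff u ≠ 0 := by
    intro h0
    refine hfk ?_
    rw [mem_tangent, hu, add_sub_cancel_left, pow_succ]
    exact mul_dvd_mul dvd_rfl (X_dvd_iff.mpr h0)
  have hF : X ^ (2 * k + 1 + 1) ∣ (f * h).series - f.series := by
    have := X_pow_dvd_subst_sub_subst h.X_dvd_series dvd_rfl _ hh f.series
    rwa [← map_algebraMap_eq_subst_X, Algebra.algebraMap_self, map_id, id] at this
  obtain ⟨t, ht⟩ := hF
  have hv : (f * h).series = X + X ^ (k + 1) * (u + X ^ (k + 1) * t) := by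
    linear_combination ht + hu
  have hv0 : constantCoeff (u + X ^ (k + 1) * t) = constantCoeff u := by simp
  set F := f * h
  have hFX := F.X_dvd_series
  obtain ⟨g, hg⟩ := exists_series_of_successive_approximation
    (P := fun i g => X ^ (k + 2) ∣ g - X ∧
      X ^ (k + 1 + i + k + 1) ∣ f.series.subst g - g.subst F.series)
    (k + 2) (g₀ := X)
    ⟨by simp, by
      have e : f.series.subst (X : ℂ⟦X⟧) = f.series := by
        rw [← map_algebraMap_eq_subst_X, Algebra.algebraMap_self, map_id, id]
      rw [subst_X F.hasSubst, e, dvd_sub_comm, ht]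
      exact Dvd.dvd.mul_right (pow_dvd_pow _ (by omega)) _⟩
    (by
      rintro i g ⟨hg, r, hr⟩
      set b := constantCoeff r / (constantCoeff u * (i + 1)) with hb
      obtain ⟨w, hw0, hw⟩ := exists_conj_defect_add_monomial (n := k + 1 + i) hk (by omega) rfl hv0
        ((pow_dvd_pow _ (by omega)).trans hg) b
      refine ⟨b, ?_, ?_⟩
      · rw [add_sub_right_comm]
        exact dvd_add hg (Dvd.dvd.mul_left (pow_dvd_pow _ (by omega)) _)
      · have e : k + 2 + i = k + 1 + i + 1 := by omega
        have e' : k + 1 + (i + 1) + k + 1 = k + 1 + i + k + 1 + 1 := by omega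
        rw [← hu, ← hv, hr, ← mul_add] at hw
        rw [e, hw, e', pow_succ _ (k + 1 + i + k + 1)]
        refine mul_dvd_mul dvd_rfl (X_dvd_iff.mpr ?_)
        have hi : (i : ℂ) + 1 ≠ 0 := Nat.cast_add_one_ne_zero i
        rw [map_add, hw0, hb]
        push_cast
        field_simp
        ring)
  have hgX : X ^ (k + 2) ∣ g - X := by
    obtain ⟨g', ⟨hg', -⟩, hgg'⟩ := hg 0
    have := dvd_add hgg' hg'
    rwa [sub_add_sub_cancel] at this
  have hgr : ∃ r, g = X * (1 + X * r) := by
    obtain ⟨r, hr⟩ := (pow_dvd_pow X (by omega : 2 ≤ k + 2)).trans hgX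
    exact ⟨r, by linear_combination hr⟩
  obtain ⟨r, hr⟩ := hgr
  have hX : X ∣ g := ⟨_, hr⟩
  refine ⟨⟨g, X_dvd_iff.mp hX, ?_⟩, hgX, FormalDiff.ext (sub_eq_zero.mp (PowerSeries.ext fun n => ?_))⟩
  · rw [hr, ← zero_add 1, coeff_succ_X_mul]
    simp
  · obtain ⟨g', ⟨hg'X, hg'⟩, hgg'⟩ := hg n
    have hX' : X ∣ g' := by
      have h1 : X ∣ g' - X := (dvd_pow_self X (by omega)).trans hg'X
      simpa using dvd_add h1 dvd_rfl
    have h1 := X_pow_dvd_subst_sub_subst hX hX' _ hgg' f.series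
    have h2 := X_pow_dvd_subst hFX hgg'
    rw [subst_sub' hFX] at h2
    have h3 := dvd_sub (dvd_add h1 ((pow_dvd_pow _ (by omega)).trans hg')) h2
    rw [series_mul, series_mul]
    rw [show f.series.subst g - f.series.subst g' + (f.series.subst g' - g'.subst F.series) -
      (g.subst F.series - g'.subst F.series) = f.series.subst g - g.subst F.series by ring] at h3
    exact X_pow_dvd_iff.mp h3 n (by omega)

/-! ### Normal subgroups and the derived series -/

theorem exists_commutator_eq {k : ℕ} (hk : 1 ≤ k) {f h : FormalDiff} (hf : f ∈ tangent k)
    (hfk : f ∉ tangent (k + 1)) (hh : h ∈ tangent (2 * k + 1)) :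
    ∃ g ∈ tangent (k + 1), h = ⁅f⁻¹, g⁻¹⁆ := by
  obtain ⟨g, hg, e⟩ := exists_conj_eq_mul hk hf hfk hh
  refine ⟨g, hg, ?_⟩
  rw [commutatorElement_def, inv_inv, inv_inv, mul_assoc _ f g, e]
  group

/-- The diffeomorphism `X + X ^ (k + 1)`, for `k ≥ 1`. -/
noncomputable def addXPow (k : ℕ) (hk : 1 ≤ k) : FormalDiff where
  series := X + X ^ (k + 1)
  constantCoeff_eq_zero := by simp
  coeff_one_ne_zero := by
    rw [map_add, coeff_one_X, coeff_X_pow, if_neg (by omega)]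
    simp

theorem addXPow_mem_tangent {k : ℕ} (hk : 1 ≤ k) : addXPow k hk ∈ tangent k := by
  simp [mem_tangent, addXPow]

theorem addXPow_notMem_tangent {k : ℕ} (hk : 1 ≤ k) : addXPow k hk ∉ tangent (k + 1) := by
  intro h
  have := X_pow_dvd_iff.mp h (k + 1) (by omega)
  simp [addXPow, coeff_X_pow] at this

theorem exists_tangent_le_derivedSeries (n : ℕ) :
    ∃ m, 1 ≤ m ∧ tangent m ≤ derivedSeries FormalDiff n := by
  induction n with
  | zero => exact ⟨1, le_rfl, fun _ _ => trivial⟩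
  | succ n ih =>
    obtain ⟨m, hm, h⟩ := ih
    refine ⟨2 * m + 1, by omega, fun x hx => ?_⟩
    obtain ⟨g, hg, rfl⟩ :=
      exists_commutator_eq hm (addXPow_mem_tangent hm) (addXPow_notMem_tangent hm) hx
    exact Subgroup.commutator_mem_commutator (inv_mem (h (addXPow_mem_tangent hm)))
      (inv_mem (h (tangent_antitone m.le_succ hg)))

/-- A diffeomorphism with linear coefficient different from `1` does not commute with `X + X ^ 2`. -/
theorem mul_addXPow_one_ne {f : FormalDiff} (hf : f ∉ tangent 1) :
    f * addXPow 1 le_rfl ≠ addXPow 1 le_rfl * f := by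
  obtain ⟨p, hp⟩ := f.X_dvd_series
  obtain ⟨q, hq⟩ := exists_eq_C_add_X_mul p
  set c := constantCoeff p
  have hfs : f.series = C c * X + X ^ 2 * q := by rw [hp, hq]; ring
  have hc : c ≠ 0 := by
    intro h
    have := f.coeff_one_ne_zero
    rw [hp, ← zero_add 1, coeff_succ_X_mul] at this
    exact this (by simpa using h)
  have hc1 : c ≠ 1 := by
    intro h
    refine hf ⟨q, ?_⟩
    rw [hfs, h, map_one]
    ring
  intro h
  have hS : X ∣ (X + X ^ 2 : ℂ⟦X⟧) := ⟨1 + X, by ring⟩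
  have hSs := hasSubst_of_X_dvd hS
  have h' : f.series.subst (X + X ^ 2 : ℂ⟦X⟧) = (X + X ^ 2 : ℂ⟦X⟧).subst f.series :=
    congrArg FormalDiff.series h
  have hmul := subst_X_add_X_pow_mul f.X_dvd_series 2 1
  rw [mul_one, ← coe_substAlgHom f.hasSubst, map_one, mul_one, coe_substAlgHom] at hmul
  rw [hmul, hfs, subst_add hSs, subst_mul hSs, subst_mul hSs, subst_pow hSs, subst_X hSs,
    subst_C] at h'
  change C c * (X + X ^ 2) + (X + X ^ 2) ^ 2 * q.subst (X + X ^ 2 : ℂ⟦X⟧) = _ at h'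
  have h2 : X ^ 2 * (C c + (1 + X) ^ 2 * q.subst (X + X ^ 2 : ℂ⟦X⟧)) =
      X ^ 2 * (q + (C c + X * q) ^ 2) := by linear_combination h'
  have h3 := congrArg constantCoeff (mul_left_cancel₀ (pow_ne_zero 2 X_ne_zero) h2)
  simp only [map_add, map_mul, map_pow, map_one, constantCoeff_C, constantCoeff_X,
    constantCoeff_subst_of_X_dvd hS] at h3
  have h4 : c * (c - 1) = 0 := by linear_combination -h3
  exact (mul_ne_zero hc (sub_ne_zero.mpr hc1)) h4

/-- The commutator of an element of `N` with `X + X ^ 2` lies in `N` and in `G_1`; it is nontrivial if the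
element is not itself in `G_1`. -/
theorem exists_mem_tangent_one_of_normal {N : Subgroup FormalDiff} [N.Normal] (hN : N ≠ ⊥) :
    ∃ f ∈ N, f ∈ tangent 1 ∧ f ≠ 1 := by
  obtain ⟨f, hf, hf1⟩ := N.bot_or_exists_ne_one.resolve_left hN
  by_cases h : f ∈ tangent 1
  · exact ⟨f, hf, h, hf1⟩
  · refine ⟨⁅f, addXPow 1 le_rfl⁆, ?_, ?_, ?_⟩
    · rw [commutatorElement_def, mul_assoc, mul_assoc]
      refine mul_mem hf ?_
      rw [← mul_assoc]
      exact Subgroup.Normal.conj_mem inferInstance _ (inv_mem hf) _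
    · exact commutator_tangent_le 0
        (Subgroup.commutator_mem_commutator (mem_tangent_zero _) (mem_tangent_zero _))
    · rw [Ne, commutatorElement_eq_one_iff_mul_comm]
      exact mul_addXPow_one_ne h

theorem exists_tangent_le_of_normal {N : Subgroup FormalDiff} [N.Normal] (hN : N ≠ ⊥) :
    ∃ m, tangent m ≤ N := by
  obtain ⟨f, hf, hf1, hne⟩ := exists_mem_tangent_one_of_normal hN
  have hex : ∃ k, f ∉ tangent k := by
    by_contra! h
    exact hne (eq_one_of_forall_mem_tangent h)
  classical
  obtain ⟨k, hk⟩ : ∃ k, Nat.find hex = k + 1 :=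
    Nat.exists_eq_succ_of_ne_zero fun h => Nat.find_spec hex (h ▸ mem_tangent_zero f)
  have hfk : f ∉ tangent (k + 1) := hk ▸ Nat.find_spec hex
  have hfk' : f ∈ tangent k := not_not.mp (Nat.find_min hex (by omega))
  have hk1 : 1 ≤ k := by
    rcases k with _ | k
    · exact absurd hf1 hfk
    · omega
  -- Every element of `G_{2k+1}` is a commutator with `f⁻¹`, hence a product of conjugates of `f⁻¹` and `f`.
  refine ⟨2 * k + 1, fun h hh => ?_⟩
  obtain ⟨g, -, rfl⟩ := exists_commutator_eq hk1 hfk' hfk hh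
  rw [commutatorElement_def, mul_assoc, mul_assoc]
  refine mul_mem (inv_mem hf) ?_
  rw [← mul_assoc, inv_inv f]
  exact Subgroup.Normal.conj_mem inferInstance _ hf _

end FormalDiff

theorem theoremC : IsHopfianGroup FormalDiff := by
  intro φ hφ
  refine ⟨(MonoidHom.ker_eq_bot_iff φ).mp (by_contra fun hker => ?_), hφ⟩
  obtain ⟨m, hm⟩ := FormalDiff.exists_tangent_le_of_normal hker
  have hbot : derivedSeries FormalDiff m = ⊥ := by
    rw [← map_derivedSeries_eq hφ m, Subgroup.map_eq_bot_iff]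
    exact (FormalDiff.derivedSeries_le_tangent m).trans hm
  obtain ⟨l, hl, hle⟩ := FormalDiff.exists_tangent_le_derivedSeries m
  have h1 : FormalDiff.addXPow l hl = 1 := by
    have := hle (FormalDiff.addXPow_mem_tangent hl)
    rwa [hbot, Subgroup.mem_bot] at this
  exact FormalDiff.addXPow_notMem_tangent hl (h1 ▸ one_mem _)
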